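/- Let $n,r\ge 0$ be integers, let $P(\lambda):=\lambda^2M+\lambda D+GG^*$ with $M,D\in\mathbb C^{n,n}$ Hermitian positive definite, $M=CC^*$ with $C\in\mathbb C^{n,n}$, and $G\in\mathbb C^{n,r}$ of rank $r$. Suppose that $P$ is hyperbolic, i.e. $(x^*Dx)^2-4(x^*Mx)(x^*GG^*x)>0$ for all nonzero $x\in\mathbb C^n$. Put $$S(\lambda):=\begin{bmatrix}\lambda M+D & G\\ G^* & -\lambda I_r\end{bmatrix},\qquad \mathcal A:=\begin{bmatrix}-C^{-1}D(C^{-1})^* & -C^{-1}G\\ (C^{-1}G)^* & 0\end{bmatrix},\qquad J:=\begin{bmatrix}-I_n & 0\\ 0& I_r\end{bmatrix}.$$ A real eigenvalue $\lambda$ of $\mathcal A$ is called $J$-positive (resp. $J$-negative) if $u^*Ju>0$ (resp. $u^*Ju<0$) for every nonzero $u$ in the spectral subspace $\mathcal N\big((\mathcal A-\lambda I)^{n+r}\big)$. Let $\Lambda^+(\mathcal A)$ and $\Lambda^-(\mathcal A)$ be the sets of $J$-positive and $J$-negative eigenvalues of $\mathcal A$. For a Hermitian matrix $H$ let $\imath_+(H)$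 and $\imath_-(H)$ be the numbers of its positive and negative eigenvalues. All numbers of eigenvalues, in particular those written $\#$ below, count algebraic multiplicities. Then: (a) $\mathcal A$ has exactly $n$ $J$-negative and exactly $r$ $J$-positive eigenvalues. (b) There is $\alpha\in\mathbb R$ such that $\lambda<\alpha$ for all $\lambda\in\Lambda^-(\mathcal A)$ and $\alpha<\lambda$ for all $\lambda\in\Lambda^+(\mathcal A)$. If $n>0$, then $\Lambda^-(\mathcal A)$ has a largest element $\lambda^-_{\max}$, and if $r>0$, then $\Lambda^+(\mathcal A)$ has a smallest element $\lambda^+_{\min}$. The following assertions are made whenever the extreme eigenvalues that they mention exist. (c) For each $\mu\in(\lambda^-_{\max},\lambda^+_{\min})$ the matrix $J\mathcal A-\mu J$ is positive definite. (d) For each $\mu\in(\lambda^-_{\max},\lambda^+_{\min})$ we have $\mu<0$, $S(\mu)>0$ and $-P(\mu)>0$. (e) Let $\mu\in\mathbb R$ not be an eigenvalue of $\mathcal A$. If $\mu>\lambda^+_{\min}$, then $$\imath_+(J\mathcal A-\mu J)=\#\{\lambda\in\Lambda^+(\mathcal A):\lambda>\mu\}+n,\qquad \imath_-(J\mathcal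 A-\mu J)=\#\{\lambda\in\Lambda^+(\mathcal A):\lambda<\mu\}.$$ If $\mu<\lambda^-_{\max}$, then $$\imath_+(J\mathcal A-\mu J)=\#\{\lambda\in\Lambda^-(\mathcal A):\lambda<\mu\}+r,\qquad \imath_-(J\mathcal A-\mu J)=\#\{\lambda\in\Lambda^-(\mathcal A):\lambda>\mu\}.$$ -/

import Mathlib

open scoped Matrix ComplexOrder

noncomputable section

/-- `P(z) = z² M + z D + K`. -/
def quadPoly {n : ℕ} (M D K : Matrix (Fin n) (Fin n) ℂ) (z : ℂ) : Matrix (Fin n) (Fin n) ℂ :=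
  z ^ 2 • M + z • D + K

/-- `P(z) = z² M + z D + K` is hyperbolic: `M > 0` and
`(x* D x)² - 4 (x* M x) (x* K x) > 0` for all nonzero `x`. In the order of `ℂ` used here, `0 < w`
means that `w` is real and positive; for Hermitian coefficients the left side is always real. -/
def IsHyperbolic {n : ℕ} (M D K : Matrix (Fin n) (Fin n) ℂ) : Prop :=
  M.PosDef ∧ ∀ x : Fin n → ℂ, x ≠ 0 →
    0 < (star x ⬝ᵥ D *ᵥ x) ^ 2 - 4 * (star x ⬝ᵥ M *ᵥ x) * (star x ⬝ᵥ K *ᵥ x)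

/-- The Hermitian pencil `S(z) = [[z M + D, G], [G*, -z I]]`. -/
def hermPencil {n r : ℕ} (M D : Matrix (Fin n) (Fin n) ℂ) (G : Matrix (Fin n) (Fin r) ℂ) (z : ℂ) :
    Matrix (Fin n ⊕ Fin r) (Fin n ⊕ Fin r) ℂ :=
  Matrix.fromBlocks (z • M + D) G Gᴴ (-(z • (1 : Matrix (Fin r) (Fin r) ℂ)))

/-- `J = diag(-I_n, I_r)`. -/
def signJ (n r : ℕ) : Matrix (Fin n ⊕ Fin r) (Fin n ⊕ Fin r) ℂ :=
  Matrix.fromBlocks (-1) 0 0 1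

/-- The standard `J`-Hermitian trimmed linearization
`[[-C⁻¹ D (C⁻¹)*, -C⁻¹ G], [(C⁻¹ G)*, 0]]` (where `M = C C*`). -/
def trimmedLin {n r : ℕ} (C D : Matrix (Fin n) (Fin n) ℂ) (G : Matrix (Fin n) (Fin r) ℂ) :
    Matrix (Fin n ⊕ Fin r) (Fin n ⊕ Fin r) ℂ :=
  Matrix.fromBlocks (-(C⁻¹ * D * (C⁻¹)ᴴ)) (-(C⁻¹ * G)) (C⁻¹ * G)ᴴ 0

section General

variable {ι : Type} [Fintype ι] [DecidableEq ι]

/-- The spectral subspace `N((A - z I)^N)`, where `N` is the size of `A`. -/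
def spectralSubspace (A : Matrix ι ι ℂ) (z : ℂ) : Submodule ℂ (ι → ℂ) :=
  LinearMap.ker (((A - z • (1 : Matrix ι ι ℂ)) ^ Fintype.card ι).mulVecLin)

/-- Every nonzero `u ∈ V` satisfies `u* J u > 0`. -/
def IsJPositive (J : Matrix ι ι ℂ) (V : Submodule ℂ (ι → ℂ)) : Prop :=
  ∀ u ∈ V, u ≠ 0 → 0 < star u ⬝ᵥ J *ᵥ u

/-- Every nonzero `u ∈ V` satisfies `u* J u < 0`. -/
def IsJNegative (J : Matrix ι ι ℂ) (V : Submodule ℂ (ι → ℂ)) : Prop :=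
  ∀ u ∈ V, u ≠ 0 → star u ⬝ᵥ J *ᵥ u < 0

/-- The set `Λ⁺(A)` of `J`-positive (real) eigenvalues of `A`. -/
def jPosEigs (J A : Matrix ι ι ℂ) : Set ℝ :=
  {x | (x : ℂ) ∈ spectrum ℂ A ∧ IsJPositive J (spectralSubspace A x)}

/-- The set `Λ⁻(A)` of `J`-negative (real) eigenvalues of `A`. -/
def jNegEigs (J A : Matrix ι ι ℂ) : Set ℝ :=
  {x | (x : ℂ) ∈ spectrum ℂ A ∧ IsJNegative J (spectralSubspace A x)}

open Classical in
/-- The number of real eigenvalues of `A` that lie in `s`, counted with algebraic multiplicity. -/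
def eigCount (A : Matrix ι ι ℂ) (s : Set ℝ) : ℕ :=
  Multiset.card (A.charpoly.roots.filter (fun z => ∃ x ∈ s, (x : ℂ) = z))

/-- `ι₊(H)`: the number of positive eigenvalues of the Hermitian matrix `H`. -/
def inertiaPos (H : Matrix ι ι ℂ) : ℕ := eigCount H (Set.Ioi 0)

/-- `ι₋(H)`: the number of negative eigenvalues of the Hermitian matrix `H`. -/
def inertiaNeg (H : Matrix ι ι ℂ) : ℕ := eigCount H (Set.Iio 0)

end General

end

/-!
Write `H(x) = J A - x J`. The whole theorem follows once `H(t)` is positive definite for some real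
`t < 0`.

*From definiteness to the assertions.* If `H(t) > 0`, a congruence `X` takes `H(t)` to `I` and `J`
to a real diagonal matrix `diag(ν)` at once (`Matrix.PosDef.exists_simultaneous_diagonalization`).
Since `J² = I`, the same `X` diagonalizes `A` by similarity, with real eigenvalues `lam i` such that
`ν i (lam i - t) = 1` (`exists_diagonalization_of_definite`). Hence the sign of `J` on the spectral
subspace of an eigenvalue is the side of `t` on which the eigenvalue lies
(`jPosEigs_eq_of_diagonalization`, `jNegEigs_eq_of_diagonalization`), and `H(x)` is congruent to
`diag(ν i (lam i - x))` for every `x` (`congruence_shift_of_diagonalization`). By Sylvester's law of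
inertia (`inertiaPos_of_congruence`, `inertiaNeg_of_congruence`), applied to `J` and to `H(x)`, all
counts reduce to counts of indices `i`.

*Existence of the definite point.* `H(x)` is congruent to the Hermitian pencil `S(x)`
(`hermPencil_eq_congruence`), and for `x < 0` a Schur complement shows that `S(x) > 0` if and only
if `-P(x) > 0` (`posDef_hermPencil_iff`). So a hyperbolic `P` has to be shown negative definite at
some point. Hyperbolicity says that each `q_v(x) = v* P(x) v` has two distinct real roots; the claim
is that one `x` separates the smaller from the larger roots for all `v` simultaneously
(`exists_forall_quadratic_neg`). For fixed `x` the cone `q_v(x) ≥ 0` is connected up to signs of `v`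
and `q_v'(x)` does not vanish on it, so `x` cannot lie at or below the smaller root of one
polynomial and at or above the larger root of another one
(`QuadraticMap.not_neg_and_pos_of_ne_zero`). The two sets of such `x` are closed, by compactness of
the unit sphere, and disjoint, so they do not cover the line. Positivity of `D` makes the point
found negative.
-/

/-! ### Hyperbolic triples of quadratic forms -/

/-- The set where a quadratic form `f` is nonnegative is connected up to the sign of vectors: two
vectors of it, one of them replaced by its negative if need be, span a segment inside it. Hence a
second form `g` without nonzero zeros on this set has constant sign there. -/
theorem QuadraticMap.not_neg_and_pos_of_ne_zero {E : Type*} [AddCommGroup E] [Module ℝ E]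
    (f g : QuadraticForm ℝ E) (h : ∀ z, z ≠ 0 → 0 ≤ f z → g z ≠ 0) {x y : E}
    (hfx : 0 ≤ f x) (hfy : 0 ≤ f y) : ¬ (g x < 0 ∧ 0 < g y) := by
  rintro ⟨hgx, hgy⟩
  wlog hp : 0 ≤ QuadraticMap.polar f x y generalizing y
  · refine this (y := -y) (by simpa using hfy) (by simpa using hgy) ?_
    rw [QuadraticMap.polar_neg_right]
    linarith
  have expand : ∀ (q : QuadraticForm ℝ E) (t : ℝ), q ((1 - t) • x + t • y) =
      (1 - t) ^ 2 * q x + t ^ 2 * q y + (1 - t) * t * QuadraticMap.polar q x y := by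
    intro q t
    rw [QuadraticMap.map_add q, QuadraticMap.polar_smul_left, QuadraticMap.polar_smul_right,
      QuadraticMap.map_smul, QuadraticMap.map_smul]
    simp only [smul_eq_mul]
    ring
  have hcont : ContinuousOn (fun t : ℝ => g ((1 - t) • x + t • y)) (Set.Icc 0 1) := by
    simp only [expand]
    fun_prop
  obtain ⟨t, ⟨ht0, ht1⟩, ht⟩ := intermediate_value_Icc zero_le_one hcont
    (show (0 : ℝ) ∈ Set.Icc _ _ by simp [hgx.le, hgy.le])
  refine h _ (fun hz => ?_) ?_ ht
  · -- a vanishing combination makes `x` and `y` proportional, so `g x` and `g y` have one sign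
    have h1 : g ((1 - t) • x) = g (t • y) := by
      rw [eq_neg_of_add_eq_zero_left hz, QuadraticMap.map_neg]
    rw [QuadraticMap.map_smul, QuadraticMap.map_smul, smul_eq_mul, smul_eq_mul] at h1
    have h2 : 0 ≤ (t * t) * g y := by positivity
    have h3 : t * t = 0 := by nlinarith [mul_self_nonneg (1 - t), mul_self_nonneg t]
    have h4 : t = 0 := by simpa using h3
    subst h4
    simp at h1
    linarith
  · rw [expand]
    have := sub_nonneg.2 ht1
    positivity

/-- If `q_x(t) = t² m(x) + t d(x) + k(x)` has two distinct real roots for every `x ≠ 0`, where `m`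
is positive definite, then some real `t` separates the smaller from the larger roots of all these
polynomials at once. The sets of those `t` that are, for some unit vector `x`, at or below the
smaller root of `q_x`, and at or above the larger one, are closed, nonempty and disjoint; since `ℝ`
is connected they do not cover it. -/
theorem exists_forall_quadratic_neg {E : Type*} [NormedAddCommGroup E] [NormedSpace ℝ E]
    [FiniteDimensional ℝ E] [Nontrivial E] (m d k : QuadraticForm ℝ E)
    (hmc : Continuous m) (hdc : Continuous d) (hkc : Continuous k)
    (hm : ∀ x, x ≠ 0 → 0 < m x) (hdisc : ∀ x, x ≠ 0 → 0 < d x ^ 2 - 4 * m x * k x) :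
    ∃ t : ℝ, ∀ x, x ≠ 0 → t ^ 2 * m x + t * d x + k x < 0 := by
  by_contra! hcon
  have closed_proj : ∀ F : Set (Metric.sphere (0 : E) 1 × ℝ), IsClosed F →
      IsClosed (Prod.snd '' F) := fun F hF => isClosedMap_snd_of_compactSpace F hF
  set F : Set (Metric.sphere (0 : E) 1 × ℝ) :=
    {p | 0 ≤ p.2 ^ 2 * m p.1 + p.2 * d p.1 + k p.1 ∧ 2 * p.2 * m p.1 + d p.1 ≤ 0}
  set F' : Set (Metric.sphere (0 : E) 1 × ℝ) :=
    {p | 0 ≤ p.2 ^ 2 * m p.1 + p.2 * d p.1 + k p.1 ∧ 0 ≤ 2 * p.2 * m p.1 + d p.1}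
  have hF : IsClosed F := by
    simp only [F, Set.ofPred_and]
    exact (isClosed_le (by fun_prop) (by fun_prop)).inter (isClosed_le (by fun_prop) (by fun_prop))
  have hF' : IsClosed F' := by
    simp only [F', Set.ofPred_and]
    exact (isClosed_le (by fun_prop) (by fun_prop)).inter (isClosed_le (by fun_prop) (by fun_prop))
  have hne : ∀ x : Metric.sphere (0 : E) 1, (x : E) ≠ 0 := fun x =>
    ne_zero_of_mem_unit_sphere x
  obtain ⟨x₀⟩ : Nonempty (Metric.sphere (0 : E) 1) :=
    (NormedSpace.sphere_nonempty.2 zero_le_one).to_subtype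
  have hroot : ∀ s : ℝ, s ^ 2 = d x₀ ^ 2 - 4 * m x₀ * k x₀ →
      ((s - d x₀) / (2 * m x₀)) ^ 2 * m x₀ + ((s - d x₀) / (2 * m x₀)) * d x₀ + k x₀ = 0 ∧
      2 * ((s - d x₀) / (2 * m x₀)) * m x₀ + d x₀ = s := by
    intro s hs
    have := (hm x₀ (hne x₀)).ne'
    constructor
    · field_simp
      linear_combination hs
    · field_simp
      ring
  have hs := Real.sq_sqrt (hdisc x₀ (hne x₀)).le
  have hcover : (Set.univ : Set ℝ) ⊆ Prod.snd '' F ∪ Prod.snd '' F' := by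
    intro t _
    obtain ⟨x, hx, hq⟩ := hcon t
    have hx' : 0 < ‖x‖ := norm_pos_iff.2 hx
    let u : Metric.sphere (0 : E) 1 := ⟨‖x‖⁻¹ • x, by simp [norm_smul, hx'.ne']⟩
    have hu : 0 ≤ t ^ 2 * m u + t * d u + k u := by
      have : t ^ 2 * m u + t * d u + k u = (‖x‖⁻¹ * ‖x‖⁻¹) * (t ^ 2 * m x + t * d x + k x) := by
        simp only [u, QuadraticMap.map_smul, smul_eq_mul]
        ring
      rw [this]
      positivity
    rcases le_total (2 * t * m u + d u) 0 with h | h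
    · exact Or.inl ⟨(u, t), ⟨hu, h⟩, rfl⟩
    · exact Or.inr ⟨(u, t), ⟨hu, h⟩, rfl⟩
  obtain ⟨t, -, ⟨⟨x, t⟩, ⟨hx, hx'⟩, rfl⟩, ⟨⟨y, s⟩, ⟨hy, hy'⟩, hst⟩⟩ :=
    isPreconnected_closed_iff.1 (isPreconnected_univ (α := ℝ)) _ _ (closed_proj F hF)
      (closed_proj F' hF') hcover
      ⟨_, trivial, (x₀, (-√(d x₀ ^ 2 - 4 * m x₀ * k x₀) - d x₀) / (2 * m x₀)),
        ⟨(hroot _ (by rw [neg_sq, hs])).1.ge, by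
          refine (hroot _ (by rw [neg_sq, hs])).2.trans_le ?_
          simp⟩, rfl⟩
      ⟨_, trivial, (x₀, (√(d x₀ ^ 2 - 4 * m x₀ * k x₀) - d x₀) / (2 * m x₀)),
        ⟨(hroot _ hs).1.ge, (Real.sqrt_nonneg _).trans_eq (hroot _ hs).2.symm⟩, rfl⟩
  obtain rfl : s = t := hst
  have key : ∀ z : E, z ≠ 0 → 0 ≤ (s ^ 2 • m + s • d + k) z → ((2 * s) • m + d) z ≠ 0 := by
    intro z hz h h0
    simp only [add_apply, smul_apply, smul_eq_mul] at h h0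
    -- `q'(s)² = (d² - 4mk) + 4m q(s)`
    nlinarith [hdisc z hz, mul_nonneg (hm z hz).le h]
  refine QuadraticMap.not_neg_and_pos_of_ne_zero _ _ key (x := (x : E)) (y := (y : E))
    (by simpa using hx) (by simpa using hy) ⟨lt_of_le_of_ne (by simpa using hx') (key _ (hne x)
    (by simpa using hx)), lt_of_le_of_ne (by simpa using hy') (key _ (hne y)
    (by simpa using hy)).symm⟩

/-! ### Simultaneous diagonalization -/

section

variable {ι : Type} [Fintype ι] [DecidableEq ι]

theorem Matrix.IsHermitian.exists_unitary_diagonalization {H : Matrix ι ι ℂ} (hH : H.IsHermitian) :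
    ∃ (U : Matrix ι ι ℂ) (e : ι → ℝ), U * star U = 1 ∧
      H * U = U * Matrix.diagonal (fun i => (e i : ℂ)) := by
  have hspec := hH.conjStarAlgAut_star_eigenvectorUnitary
  rw [Unitary.conjStarAlgAut_star_apply] at hspec
  obtain ⟨U, hU⟩ : ∃ U : Matrix ι ι ℂ, U = (hH.eigenvectorUnitary : Matrix ι ι ℂ) := ⟨_, rfl⟩
  have hUU : U * star U = 1 := hU ▸ Unitary.coe_mul_star_self hH.eigenvectorUnitary
  rw [← hU] at hspec
  refine ⟨U, hH.eigenvalues, hUU, Eq.trans ?_ (congrArg (U * ·) hspec)⟩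
  rw [mul_assoc (star U), ← mul_assoc U, hUU, one_mul]

/-- A Hermitian matrix is diagonalized by a congruence that takes a given positive definite matrix
to the identity. -/
theorem Matrix.PosDef.exists_simultaneous_diagonalization {B J : Matrix ι ι ℂ} (hB : B.PosDef)
    (hJ : J.IsHermitian) : ∃ (X : Matrix ι ι ℂ) (ν : ι → ℝ), IsUnit X ∧ Xᴴ * B * X = 1 ∧
      Xᴴ * J * X = Matrix.diagonal (fun i => (ν i : ℂ)) := by
  obtain ⟨Q, rfl⟩ : ∃ Q : Matrix ι ι ℂ, B = Qᴴ * Q := by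
    open scoped MatrixOrder in
    exact CStarAlgebra.nonneg_iff_eq_star_mul_self.mp hB.posSemidef.nonneg
  have hQ : IsUnit Q := by
    have := (Matrix.isUnit_iff_isUnit_det _).1 hB.isUnit
    rw [Matrix.det_mul] at this
    exact (Matrix.isUnit_iff_isUnit_det _).2 (isUnit_of_mul_isUnit_right this)
  have hQd := (Matrix.isUnit_iff_isUnit_det _).1 hQ
  have hK : ((Q⁻¹)ᴴ * J * Q⁻¹).IsHermitian := Matrix.isHermitian_conjTranspose_mul_mul _ hJ
  obtain ⟨U, e, hUU', hKU⟩ := hK.exists_unitary_diagonalization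
  have hUU : star U * U = 1 := mul_eq_one_comm.1 hUU'
  refine ⟨Q⁻¹ * U, e, ?_, ?_, ?_⟩
  · exact (Matrix.isUnit_nonsing_inv_iff.2 hQ).mul (IsUnit.of_mul_eq_one_right _ hUU)
  · have h1 : Q * Q⁻¹ = 1 := Matrix.mul_nonsing_inv _ hQd
    have h2 : (Q⁻¹)ᴴ * Qᴴ = 1 := by rw [← Matrix.conjTranspose_mul, h1, Matrix.conjTranspose_one]
    calc (Q⁻¹ * U)ᴴ * (Qᴴ * Q) * (Q⁻¹ * U) = Uᴴ * ((Q⁻¹)ᴴ * Qᴴ) * (Q * Q⁻¹) * U := by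
          rw [Matrix.conjTranspose_mul]; noncomm_ring
      _ = 1 := by rw [h1, h2, mul_one, mul_one]; exact hUU
  · calc (Q⁻¹ * U)ᴴ * J * (Q⁻¹ * U) = star U * ((Q⁻¹)ᴴ * J * Q⁻¹) * U := by
          rw [Matrix.conjTranspose_mul, Matrix.star_eq_conjTranspose]; noncomm_ring
      _ = _ := by rw [mul_assoc, hKU, ← mul_assoc, hUU, one_mul]

/-- If `J A` and `J` are Hermitian and `J A - t J` is positive definite for some real `t`, then `A`
is diagonalizable with real eigenvalues `lam i`, by a basis that is orthogonal for `J`; the sign of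
the basis vector `i` in the form `J` is that of `lam i - t`. -/
theorem exists_diagonalization_of_definite {A J : Matrix ι ι ℂ} {t : ℝ} (hJ : J.IsHermitian)
    (hJJ : J * J = 1) (hB : (J * A - (t : ℂ) • J).PosDef) :
    ∃ (X : Matrix ι ι ℂ) (ν lam : ι → ℝ), IsUnit X ∧
      Xᴴ * J * X = Matrix.diagonal (fun i => (ν i : ℂ)) ∧
      A * X = X * Matrix.diagonal (fun i => (lam i : ℂ)) ∧ ∀ i, ν i * (lam i - t) = 1 := by
  obtain ⟨X, ν, hX, hXB, hXJ⟩ := hB.exists_simultaneous_diagonalization hJ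
  have hXd := (Matrix.isUnit_iff_isUnit_det _).1 hX
  have hXX : X * X⁻¹ = 1 := Matrix.mul_nonsing_inv _ hXd
  have hν : ∀ i, ν i ≠ 0 := by
    intro i hi
    have hu : IsUnit (Matrix.diagonal (fun i => (ν i : ℂ))) := by
      rw [← hXJ]
      exact (hX.star.mul (IsUnit.of_mul_eq_one _ hJJ)).mul hX
    rw [Matrix.isUnit_diagonal, Pi.isUnit_iff] at hu
    simpa [hi] using hu i
  have hprod : Matrix.diagonal (fun i => (ν i : ℂ)) * (X⁻¹ * (A - (t : ℂ) • 1) * X) = 1 := by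
    rw [← hXJ]
    calc Xᴴ * J * X * (X⁻¹ * (A - (t : ℂ) • 1) * X) = Xᴴ * J * (X * X⁻¹) * (A - (t : ℂ) • 1) * X := by
          noncomm_ring
      _ = Xᴴ * (J * (A - (t : ℂ) • 1)) * X := by rw [hXX]; noncomm_ring
      _ = 1 := by rw [mul_sub, Matrix.mul_smul, mul_one, hXB]
  have hdiag : X⁻¹ * (A - (t : ℂ) • 1) * X = Matrix.diagonal (fun i => ((ν i : ℂ))⁻¹) := by
    have hinv : Matrix.diagonal (fun i => ((ν i : ℂ))⁻¹) * Matrix.diagonal (fun i => (ν i : ℂ)) =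
        1 := by
      rw [Matrix.diagonal_mul_diagonal, ← Matrix.diagonal_one]
      congr 1
      ext i
      simp [hν i]
    exact (left_inv_eq_right_inv hinv hprod).symm
  refine ⟨X, ν, fun i => t + (ν i)⁻¹, hX, hXJ, ?_, fun i => by simp [hν i]⟩
  have h1 : (A - (t : ℂ) • 1) * X = X * Matrix.diagonal (fun i => ((ν i : ℂ))⁻¹) := by
    rw [← hdiag, mul_assoc X⁻¹, ← mul_assoc X, hXX, one_mul]
  have h2 : Matrix.diagonal (fun i => ((t + (ν i)⁻¹ : ℝ) : ℂ)) =
      (t : ℂ) • (1 : Matrix ι ι ℂ) + Matrix.diagonal (fun i => ((ν i : ℂ))⁻¹) := by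
    ext i j
    by_cases h : i = j <;> simp [h, Matrix.diagonal]
  rw [h2, mul_add, ← h1, sub_mul]
  simp

/-! ### Eigenvalue counts and inertia -/

/-- The number of eigenvalues of a diagonalized matrix in `s`. -/
theorem eigCount_of_diagonalization {A X : Matrix ι ι ℂ} {lam : ι → ℝ} (hX : IsUnit X)
    (hA : A * X = X * Matrix.diagonal (fun i => (lam i : ℂ))) (s : Set ℝ) :
    eigCount A s = Nat.card {i // lam i ∈ s} := by
  classical
  obtain ⟨U, rfl⟩ := hX
  have hconj : A = U * Matrix.diagonal (fun i => (lam i : ℂ)) * (U⁻¹ : (Matrix ι ι ℂ)ˣ) := by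
    rw [← hA, mul_assoc]
    simp
  have hroots : A.charpoly.roots = Finset.univ.val.map (fun i => (lam i : ℂ)) := by
    rw [hconj, Matrix.coe_units_inv, Matrix.charpoly_units_conj, Matrix.charpoly_diagonal,
      ← Polynomial.roots_multiset_prod_X_sub_C (Finset.univ.val.map (fun i => (lam i : ℂ))),
      Multiset.map_map]
    rfl
  rw [eigCount, hroots, Multiset.filter_map, Multiset.card_map, Nat.card_eq_fintype_card,
    Fintype.card_subtype, Finset.card, Finset.filter_val]
  congr 2
  ext i
  simp

theorem mem_spectrum_of_diagonalization {A X : Matrix ι ι ℂ} {lam : ι → ℝ} (hX : IsUnit X)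
    (hA : A * X = X * Matrix.diagonal (fun i => (lam i : ℂ))) (x : ℝ) :
    (x : ℂ) ∈ spectrum ℂ A ↔ ∃ i, lam i = x := by
  obtain ⟨U, rfl⟩ := hX
  have : A = U * Matrix.diagonal (fun i => (lam i : ℂ)) * (U⁻¹ : (Matrix ι ι ℂ)ˣ) := by
    rw [← hA, mul_assoc]
    simp
  rw [this, spectrum.units_conjugate, spectrum_diagonal]
  simp

theorem star_dotProduct_diagonal_mulVec (d : ι → ℝ) (v : ι → ℂ) :
    star v ⬝ᵥ Matrix.diagonal (fun i => (d i : ℂ)) *ᵥ v =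
      ((∑ i, d i * Complex.normSq (v i) : ℝ) : ℂ) := by
  simp only [dotProduct, Matrix.mulVec_diagonal, Complex.ofReal_sum, Complex.ofReal_mul,
    Complex.normSq_eq_conj_mul_self, Pi.star_apply, Complex.star_def]
  exact Finset.sum_congr rfl fun i _ => by ring

theorem star_mulVec_dotProduct_mulVec {ι : Type} [Fintype ι] (X H : Matrix ι ι ℂ) (v : ι → ℂ) :
    star (X *ᵥ v) ⬝ᵥ H *ᵥ (X *ᵥ v) = star v ⬝ᵥ (Xᴴ * H * X) *ᵥ v := by
  rw [Matrix.star_mulVec, ← Matrix.dotProduct_mulVec, Matrix.mulVec_mulVec, Matrix.mulVec_mulVec,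
    mul_assoc]

/-- A congruence of real diagonal matrices, even by a singular matrix, does not increase the number
of positive entries: restricting the coordinates of `Y v` to the positive entries of `d` is
injective on the vectors `v` supported in the positive entries of `e`. -/
theorem card_pos_le_of_congruence {Y : Matrix ι ι ℂ} {d e : ι → ℝ}
    (h : Yᴴ * Matrix.diagonal (fun i => (d i : ℂ)) * Y = Matrix.diagonal (fun i => (e i : ℂ))) :
    Nat.card {i // 0 < e i} ≤ Nat.card {i // 0 < d i} := by
  classical
  let f : ({i // 0 < e i} → ℂ) →ₗ[ℂ] ({i // 0 < d i} → ℂ) :=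
    LinearMap.funLeft ℂ ℂ Subtype.val ∘ₗ Y.mulVecLin ∘ₗ
      Function.ExtendByZero.linearMap ℂ Subtype.val
  have hf : Function.Injective f := by
    rw [← LinearMap.ker_eq_bot, LinearMap.ker_eq_bot']
    intro v hv
    set w : ι → ℂ := Function.extend Subtype.val v 0 with hw
    have hw_val : ∀ i : {i // 0 < e i}, w i = v i := fun i =>
      Subtype.val_injective.extend_apply v 0 i
    have hw_zero : ∀ i, ¬ 0 < e i → w i = 0 := fun i hi =>
      Function.extend_apply' _ _ _ (by rintro ⟨j, rfl⟩; exact hi j.2)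
    have hYw : ∀ i, 0 < d i → (Y *ᵥ w) i = 0 := fun i hi => congrFun hv ⟨i, hi⟩
    have heq : (∑ i, e i * Complex.normSq (w i)) = ∑ i, d i * Complex.normSq ((Y *ᵥ w) i) := by
      have := star_mulVec_dotProduct_mulVec Y (Matrix.diagonal (fun i => (d i : ℂ))) w
      rw [h, star_dotProduct_diagonal_mulVec, star_dotProduct_diagonal_mulVec] at this
      exact_mod_cast this.symm
    have hle : (∑ i, d i * Complex.normSq ((Y *ᵥ w) i)) ≤ 0 := by
      refine Finset.sum_nonpos fun i _ => ?_
      by_cases hi : 0 < d i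
      · simp [hYw i hi]
      · exact mul_nonpos_of_nonpos_of_nonneg (not_lt.1 hi) (Complex.normSq_nonneg _)
    have hterm : ∀ i ∈ Finset.univ, 0 ≤ e i * Complex.normSq (w i) := by
      intro i _
      by_cases hi : 0 < e i
      · exact mul_nonneg hi.le (Complex.normSq_nonneg _)
      · simp [hw_zero i hi]
    have hzero := (Finset.sum_eq_zero_iff_of_nonneg hterm).1
      (le_antisymm (heq.trans_le hle) (Finset.sum_nonneg hterm))
    ext i
    have := hzero i (Finset.mem_univ _)
    rw [hw_val, mul_eq_zero, Complex.normSq_eq_zero] at this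
    exact this.resolve_left i.2.ne'
  have := LinearMap.finrank_le_finrank_of_injective hf
  simpa [Module.finrank_fintype_fun_eq_card, Nat.card_eq_fintype_card] using this

/-- Sylvester's law of inertia for real diagonal matrices. -/
theorem card_pos_eq_of_congruence {Y : Matrix ι ι ℂ} (hY : IsUnit Y) {d e : ι → ℝ}
    (h : Yᴴ * Matrix.diagonal (fun i => (d i : ℂ)) * Y = Matrix.diagonal (fun i => (e i : ℂ))) :
    Nat.card {i // 0 < e i} = Nat.card {i // 0 < d i} := by
  have hYY : Y * Y⁻¹ = 1 := Matrix.mul_nonsing_inv _ ((Matrix.isUnit_iff_isUnit_det _).1 hY)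
  refine le_antisymm (card_pos_le_of_congruence h) (card_pos_le_of_congruence (Y := Y⁻¹) ?_)
  have hYY' : (Y⁻¹)ᴴ * Yᴴ = 1 := by
    rw [← Matrix.conjTranspose_mul, hYY, Matrix.conjTranspose_one]
  rw [← h]
  calc (Y⁻¹)ᴴ * (Yᴴ * Matrix.diagonal (fun i => (d i : ℂ)) * Y) * Y⁻¹
      = ((Y⁻¹)ᴴ * Yᴴ) * Matrix.diagonal (fun i => (d i : ℂ)) * (Y * Y⁻¹) := by noncomm_ring
    _ = _ := by rw [hYY, hYY', one_mul, mul_one]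

/-- Sylvester's law of inertia: the positive eigenvalues of a Hermitian matrix are counted by any
diagonalizing congruence. -/
theorem inertiaPos_of_congruence {H X : Matrix ι ι ℂ} {d : ι → ℝ} (hH : H.IsHermitian)
    (hX : IsUnit X) (h : Xᴴ * H * X = Matrix.diagonal (fun i => (d i : ℂ))) :
    inertiaPos H = Nat.card {i // 0 < d i} := by
  obtain ⟨U, e, hUU, hHU⟩ := hH.exists_unitary_diagonalization
  have hUunit : IsUnit U := IsUnit.of_mul_eq_one _ hUU
  have hHdec : H = U * Matrix.diagonal (fun i => (e i : ℂ)) * star U := by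
    rw [← hHU, mul_assoc, hUU, mul_one]
  rw [inertiaPos, eigCount_of_diagonalization hUunit hHU]
  refine (card_pos_eq_of_congruence (Y := star U * X) (hUunit.star.mul hX) ?_).symm
  rw [← h]
  conv_rhs => rw [hHdec]
  rw [Matrix.conjTranspose_mul, Matrix.star_eq_conjTranspose, Matrix.conjTranspose_conjTranspose]
  noncomm_ring

theorem inertiaNeg_eq_inertiaPos_neg {H : Matrix ι ι ℂ} (hH : H.IsHermitian) :
    inertiaNeg H = inertiaPos (-H) := by
  obtain ⟨U, e, hUU, hHU⟩ := hH.exists_unitary_diagonalization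
  have hUunit : IsUnit U := IsUnit.of_mul_eq_one _ hUU
  have hHU' : -H * U = U * Matrix.diagonal (fun i => ((-e i : ℝ) : ℂ)) := by
    have : Matrix.diagonal (fun i => ((-e i : ℝ) : ℂ)) =
        -Matrix.diagonal (fun i => (e i : ℂ)) := by
      rw [Matrix.diagonal_neg]
      simp
    rw [this, neg_mul, hHU, mul_neg]
  rw [inertiaNeg, inertiaPos, eigCount_of_diagonalization hUunit hHU,
    eigCount_of_diagonalization hUunit hHU']
  simp

theorem inertiaNeg_of_congruence {H X : Matrix ι ι ℂ} {d : ι → ℝ} (hH : H.IsHermitian)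
    (hX : IsUnit X) (h : Xᴴ * H * X = Matrix.diagonal (fun i => (d i : ℂ))) :
    inertiaNeg H = Nat.card {i // d i < 0} := by
  rw [inertiaNeg_eq_inertiaPos_neg hH,
    inertiaPos_of_congruence (d := fun i => -d i) hH.neg hX ?_]
  · simp
  · rw [mul_neg, neg_mul, h, Matrix.diagonal_neg]
    simp

end

/-! ### Sign types of eigenvalues of a definite pencil -/

section

variable {ι : Type} [Fintype ι] [DecidableEq ι]

/-- Vectors of the spectral subspace of `A` at `x` are combinations of the basis vectors whose
eigenvalue is `x`; all of these have the sign of `x - t` in the form `J`. -/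
theorem star_dotProduct_mulVec_of_mem_spectralSubspace {A J X : Matrix ι ι ℂ} {ν lam : ι → ℝ}
    {t x : ℝ} (hX : IsUnit X) (hXJ : Xᴴ * J * X = Matrix.diagonal (fun i => (ν i : ℂ)))
    (hA : A * X = X * Matrix.diagonal (fun i => (lam i : ℂ)))
    (hν : ∀ i, ν i * (lam i - t) = 1) {u : ι → ℂ} (hu : u ∈ spectralSubspace A x) (hu0 : u ≠ 0) :
    ∃ c : ℝ, 0 < c ∧ star u ⬝ᵥ J *ᵥ u = (((x - t)⁻¹ * c : ℝ) : ℂ) := by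
  have hXd := (Matrix.isUnit_iff_isUnit_det _).1 hX
  set v := X⁻¹ *ᵥ u
  have huv : u = X *ᵥ v := by
    rw [Matrix.mulVec_mulVec, Matrix.mul_nonsing_inv _ hXd, Matrix.one_mulVec]
  have hsub : (A - (x : ℂ) • (1 : Matrix ι ι ℂ)) * X =
      X * Matrix.diagonal (fun i => (lam i : ℂ) - x) := by
    have : Matrix.diagonal (fun i => (lam i : ℂ) - x) =
        Matrix.diagonal (fun i => (lam i : ℂ)) - (x : ℂ) • (1 : Matrix ι ι ℂ) := by
      rw [Matrix.smul_one_eq_diagonal, Matrix.diagonal_sub]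
    rw [this, sub_mul, hA, mul_sub]
    simp
  have hpow : (A - (x : ℂ) • (1 : Matrix ι ι ℂ)) ^ Fintype.card ι * X =
      X * Matrix.diagonal (fun i => ((lam i : ℂ) - x) ^ Fintype.card ι) := by
    have := SemiconjBy.pow_right (a := X) hsub.symm (Fintype.card ι)
    rw [Matrix.diagonal_pow] at this
    exact this.eq.symm
  have hv : ∀ i, lam i ≠ x → v i = 0 := by
    intro i hi
    have h1 : (A - (x : ℂ) • (1 : Matrix ι ι ℂ)) ^ Fintype.card ι *ᵥ u = 0 := hu
    rw [huv, Matrix.mulVec_mulVec, hpow, ← Matrix.mulVec_mulVec] at h1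
    have h2 := congrFun (Matrix.mulVec_injective_of_isUnit hX
      (h1.trans (Matrix.mulVec_zero X).symm)) i
    rw [Matrix.mulVec_diagonal] at h2
    refine (mul_eq_zero.1 h2).resolve_left (pow_ne_zero _ (sub_ne_zero.2 ?_))
    exact_mod_cast hi
  have hv0 : v ≠ 0 := fun h => hu0 (by rw [huv, h, Matrix.mulVec_zero])
  refine ⟨∑ i, Complex.normSq (v i), ?_, ?_⟩
  · obtain ⟨i, hi⟩ := Function.ne_iff.1 hv0
    exact Finset.sum_pos' (fun i _ => Complex.normSq_nonneg _)
      ⟨i, Finset.mem_univ _, Complex.normSq_pos.2 hi⟩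
  · rw [huv, star_mulVec_dotProduct_mulVec, hXJ, star_dotProduct_diagonal_mulVec, Finset.mul_sum]
    congr 1
    refine Finset.sum_congr rfl fun i _ => ?_
    by_cases hi : lam i = x
    · rw [← hi, eq_inv_of_mul_eq_one_left (hν i)]
    · simp [hv i hi]

theorem exists_ne_zero_mem_spectralSubspace {A : Matrix ι ι ℂ} {z : ℂ} (hz : z ∈ spectrum ℂ A) :
    ∃ u ∈ spectralSubspace A z, u ≠ 0 := by
  rw [spectrum.mem_iff, ← IsUnit.neg_iff, neg_sub, Algebra.algebraMap_eq_smul_one] at hz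
  have hcard : Fintype.card ι ≠ 0 := by
    intro h
    have := Fintype.card_eq_zero_iff.1 h
    exact hz (isUnit_of_subsingleton _)
  rw [← isUnit_pow_iff hcard, Matrix.isUnit_iff_isUnit_det, isUnit_iff_ne_zero, not_not] at hz
  obtain ⟨u, hu0, hu⟩ := Matrix.exists_mulVec_eq_zero_iff.2 hz
  exact ⟨u, hu, hu0⟩

theorem jPosEigs_eq_of_diagonalization {A J X : Matrix ι ι ℂ} {ν lam : ι → ℝ}
    {t : ℝ} (hX : IsUnit X) (hXJ : Xᴴ * J * X = Matrix.diagonal (fun i => (ν i : ℂ)))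
    (hA : A * X = X * Matrix.diagonal (fun i => (lam i : ℂ)))
    (hν : ∀ i, ν i * (lam i - t) = 1) : jPosEigs J A = Set.range lam ∩ Set.Ioi t := by
  ext x
  refine and_congr_right_iff.2 (fun hx => ⟨fun h => ?_, fun h u hu hu0 => ?_⟩) |>.trans
    (and_congr_left' (mem_spectrum_of_diagonalization hX hA x))
  · obtain ⟨u, hu, hu0⟩ := exists_ne_zero_mem_spectralSubspace hx
    obtain ⟨c, hc, hcu⟩ := star_dotProduct_mulVec_of_mem_spectralSubspace hX hXJ hA hν hu hu0
    have := h u hu hu0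
    rw [hcu, Complex.zero_lt_real, mul_pos_iff_of_pos_right hc, inv_pos, sub_pos] at this
    exact this
  · obtain ⟨c, hc, hcu⟩ := star_dotProduct_mulVec_of_mem_spectralSubspace hX hXJ hA hν hu hu0
    rw [hcu, Complex.zero_lt_real, mul_pos_iff_of_pos_right hc, inv_pos, sub_pos]
    exact h

theorem jNegEigs_eq_of_diagonalization {A J X : Matrix ι ι ℂ} {ν lam : ι → ℝ}
    {t : ℝ} (hX : IsUnit X) (hXJ : Xᴴ * J * X = Matrix.diagonal (fun i => (ν i : ℂ)))
    (hA : A * X = X * Matrix.diagonal (fun i => (lam i : ℂ)))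
    (hν : ∀ i, ν i * (lam i - t) = 1) : jNegEigs J A = Set.range lam ∩ Set.Iio t := by
  ext x
  refine and_congr_right_iff.2 (fun hx => ⟨fun h => ?_, fun h u hu hu0 => ?_⟩) |>.trans
    (and_congr_left' (mem_spectrum_of_diagonalization hX hA x))
  · obtain ⟨u, hu, hu0⟩ := exists_ne_zero_mem_spectralSubspace hx
    obtain ⟨c, hc, hcu⟩ := star_dotProduct_mulVec_of_mem_spectralSubspace hX hXJ hA hν hu hu0
    have := h u hu hu0
    rw [hcu, ← Complex.ofReal_zero, Complex.real_lt_real, ← neg_pos, ← neg_mul,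
      mul_pos_iff_of_pos_right hc, neg_pos, inv_lt_zero, sub_neg] at this
    exact this
  · obtain ⟨c, hc, hcu⟩ := star_dotProduct_mulVec_of_mem_spectralSubspace hX hXJ hA hν hu hu0
    rw [hcu, ← Complex.ofReal_zero, Complex.real_lt_real, ← neg_pos, ← neg_mul,
      mul_pos_iff_of_pos_right hc, neg_pos, inv_lt_zero, sub_neg]
    exact h

/-- The basis that diagonalizes `A` and `J` also diagonalizes every `J A - x J`. -/
theorem congruence_shift_of_diagonalization {A J X : Matrix ι ι ℂ} {ν lam : ι → ℝ}
    (hXJ : Xᴴ * J * X = Matrix.diagonal (fun i => (ν i : ℂ)))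
    (hA : A * X = X * Matrix.diagonal (fun i => (lam i : ℂ))) (x : ℝ) :
    Xᴴ * (J * A - (x : ℂ) • J) * X =
      Matrix.diagonal (fun i => ((ν i * (lam i - x) : ℝ) : ℂ)) := by
  have h1 : Xᴴ * (J * A - (x : ℂ) • J) * X = Xᴴ * J * (A * X) - (x : ℂ) • (Xᴴ * J * X) := by
    rw [mul_sub, sub_mul, mul_smul_comm, smul_mul_assoc]
    simp only [mul_assoc]
  rw [h1, hA, ← mul_assoc, hXJ, Matrix.diagonal_mul_diagonal, ← Matrix.diagonal_smul,
    Matrix.diagonal_sub]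
  congr 1
  ext i
  simp
  ring

theorem signJ_isHermitian (n r : ℕ) : (signJ n r).IsHermitian := by
  simp [signJ, Matrix.IsHermitian, Matrix.fromBlocks_conjTranspose]

theorem signJ_mul_self (n r : ℕ) : signJ n r * signJ n r = 1 := by
  simp [signJ, Matrix.fromBlocks_multiply]

theorem signJ_eq_diagonal (n r : ℕ) :
    signJ n r = Matrix.diagonal (fun i => ((Sum.elim (fun _ => -1) (fun _ => 1) i : ℝ) : ℂ)) := by
  rw [signJ, ← Matrix.diagonal_one, ← Matrix.diagonal_one, Matrix.diagonal_neg,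
    Matrix.fromBlocks_diagonal]
  congr 1
  ext i
  cases i <;> simp

theorem inertiaPos_signJ (n r : ℕ) : inertiaPos (signJ n r) = r := by
  rw [inertiaPos_of_congruence (signJ_isHermitian n r) isUnit_one
    (by rw [Matrix.conjTranspose_one, one_mul, mul_one]; exact signJ_eq_diagonal n r),
    Nat.card_eq_fintype_card, Fintype.card_subtype, Finset.card_filter, Fintype.sum_sum_type]
  simp

theorem inertiaNeg_signJ (n r : ℕ) : inertiaNeg (signJ n r) = n := by
  rw [inertiaNeg_of_congruence (signJ_isHermitian n r) isUnit_one
    (by rw [Matrix.conjTranspose_one, one_mul, mul_one]; exact signJ_eq_diagonal n r),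
    Nat.card_eq_fintype_card, Fintype.card_subtype, Finset.card_filter, Fintype.sum_sum_type]
  simp [not_lt.2 zero_le_one]

end

/-! ### The trimmed linearization of a hyperbolic polynomial -/

section

variable {n r : ℕ}

/-- The real quadratic form `x ↦ re (x* H x)`. -/
noncomputable def reQuadForm (H : Matrix (Fin n) (Fin n) ℂ) : QuadraticForm ℝ (Fin n → ℂ) :=
  LinearMap.BilinMap.toQuadraticMap (LinearMap.mk₂ ℝ (fun x y => (star x ⬝ᵥ H *ᵥ y).re)
    (by simp [add_dotProduct])
    (by simp)
    (by simp [Matrix.mulVec_add])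
    (by simp [Matrix.mulVec_smul]))

theorem continuous_reQuadForm (H : Matrix (Fin n) (Fin n) ℂ) : Continuous (reQuadForm H) := by
  change Continuous fun x => (star x ⬝ᵥ H *ᵥ x).re
  fun_prop

theorem Matrix.IsHermitian.star_dotProduct_mulVec_eq {H : Matrix (Fin n) (Fin n) ℂ}
    (hH : H.IsHermitian) (x : Fin n → ℂ) : star x ⬝ᵥ H *ᵥ x = (reQuadForm H x : ℂ) :=
  Complex.ext rfl (by simpa using hH.im_star_dotProduct_mulVec_self x)

theorem isHermitian_quadPoly {M D K : Matrix (Fin n) (Fin n) ℂ} (hM : M.IsHermitian)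
    (hD : D.IsHermitian) (hK : K.IsHermitian) (t : ℝ) : (quadPoly M D K (t : ℂ)).IsHermitian := by
  simp [quadPoly, Matrix.IsHermitian, hM.eq, hD.eq, hK.eq, Matrix.conjTranspose_smul]

/-- A hyperbolic quadratic polynomial with positive definite damping and positive semidefinite
stiffness is negative definite at some negative point. -/
theorem IsHyperbolic.exists_neg_posDef_neg_quadPoly {M D K : Matrix (Fin n) (Fin n) ℂ}
    (hD : D.PosDef) (hK : K.PosSemidef) (hP : IsHyperbolic M D K) :
    ∃ t : ℝ, t < 0 ∧ (-quadPoly M D K (t : ℂ)).PosDef := by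
  obtain ⟨hM, hP⟩ := hP
  rcases Nat.eq_zero_or_pos n with rfl | hn
  · exact ⟨-1, by norm_num, Matrix.PosDef.of_dotProduct_mulVec_pos
      (Subsingleton.elim _ _) fun x hx => (hx (Subsingleton.elim _ _)).elim⟩
  have : Nonempty (Fin n) := ⟨⟨0, hn⟩⟩
  have hMf : ∀ x, x ≠ 0 → 0 < reQuadForm M x := fun x hx => by
    have := hM.dotProduct_mulVec_pos hx
    rwa [hM.1.star_dotProduct_mulVec_eq, Complex.zero_lt_real] at this
  have hDf : ∀ x, x ≠ 0 → 0 < reQuadForm D x := fun x hx => by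
    have := hD.dotProduct_mulVec_pos hx
    rwa [hD.1.star_dotProduct_mulVec_eq, Complex.zero_lt_real] at this
  have hKf : ∀ x, 0 ≤ reQuadForm K x := fun x => by
    have := hK.dotProduct_mulVec_nonneg x
    rwa [hK.1.star_dotProduct_mulVec_eq, Complex.zero_le_real] at this
  obtain ⟨t, ht⟩ := exists_forall_quadratic_neg (reQuadForm M) (reQuadForm D) (reQuadForm K)
    (continuous_reQuadForm M) (continuous_reQuadForm D) (continuous_reQuadForm K) hMf
    (fun x hx => by
      have := hP x hx
      rw [hM.1.star_dotProduct_mulVec_eq, hD.1.star_dotProduct_mulVec_eq,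
        hK.1.star_dotProduct_mulVec_eq] at this
      exact_mod_cast this)
  refine ⟨t, ?_, Matrix.PosDef.of_dotProduct_mulVec_pos
    (isHermitian_quadPoly hM.1 hD.1 hK.1 t).neg fun x hx => ?_⟩
  · by_contra! h
    obtain ⟨x, hx⟩ := exists_ne (0 : Fin n → ℂ)
    have := ht x hx
    have h1 := (hMf x hx).le
    have h2 := (hDf x hx).le
    have h3 := hKf x
    have : 0 ≤ t ^ 2 * reQuadForm M x + t * reQuadForm D x + reQuadForm K x := by positivity
    linarith
  · have h : star x ⬝ᵥ (-quadPoly M D K (t : ℂ)) *ᵥ x =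
        ((-(t ^ 2 * reQuadForm M x + t * reQuadForm D x + reQuadForm K x) : ℝ) : ℂ) := by
      simp only [quadPoly, Matrix.neg_mulVec, Matrix.add_mulVec, Matrix.smul_mulVec,
        dotProduct_neg, dotProduct_add, dotProduct_smul, hM.1.star_dotProduct_mulVec_eq,
        hD.1.star_dotProduct_mulVec_eq, hK.1.star_dotProduct_mulVec_eq, smul_eq_mul]
      push_cast
      ring
    rw [h, Complex.zero_lt_real]
    linarith [ht x hx]

theorem Matrix.posDef_fromBlocks_diagonal_iff {P : Matrix (Fin n) (Fin n) ℂ}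
    {Q : Matrix (Fin r) (Fin r) ℂ} :
    (Matrix.fromBlocks P 0 0 Q).PosDef ↔ P.PosDef ∧ Q.PosDef := by
  constructor
  · intro h
    exact ⟨h.submatrix (e := Sum.inl) Sum.inl_injective,
      h.submatrix (e := Sum.inr) Sum.inr_injective⟩
  · rintro ⟨hP, hQ⟩
    refine Matrix.PosDef.of_dotProduct_mulVec_pos
      (Matrix.IsHermitian.fromBlocks hP.1 (by simp) hQ.1) fun x hx => ?_
    obtain ⟨a, b, rfl⟩ : ∃ a b, x = Sum.elim a b := ⟨x ∘ Sum.inl, x ∘ Sum.inr, by simp⟩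
    have hstar : star (Sum.elim a b) = Sum.elim (star a) (star b) := by
      ext i
      cases i <;> rfl
    rw [Matrix.fromBlocks_mulVec, hstar, sumElim_dotProduct_sumElim]
    simp only [Sum.elim_comp_inl, Sum.elim_comp_inr, Matrix.zero_mulVec, add_zero, zero_add]
    by_cases ha : a = 0
    · have hb : b ≠ 0 := by
        rintro rfl
        subst ha
        exact hx (by ext i; cases i <;> rfl)
      simpa [ha] using hQ.dotProduct_mulVec_pos hb
    · exact add_pos_of_pos_of_nonneg (hP.dotProduct_mulVec_pos ha)
        (hQ.posSemidef.dotProduct_mulVec_nonneg b)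

/-- The Schur complement of `-t I` in the pencil is `t⁻¹ P(t)`. -/
theorem posDef_hermPencil_iff {M D : Matrix (Fin n) (Fin n) ℂ} {G : Matrix (Fin n) (Fin r) ℂ}
    {t : ℝ} (ht : t < 0) :
    (hermPencil M D G (t : ℂ)).PosDef ↔ (-quadPoly M D (G * Gᴴ) (t : ℂ)).PosDef := by
  have htc : (t : ℂ) ≠ 0 := by exact_mod_cast ht.ne
  have hneg : (0 : ℝ) < -t := neg_pos.2 ht
  let T : Matrix (Fin n ⊕ Fin r) (Fin n ⊕ Fin r) ℂ := Matrix.fromBlocks 1 ((t : ℂ)⁻¹ • G) 0 1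
  have hT : IsUnit T := by
    rw [Matrix.isUnit_iff_isUnit_det, Matrix.det_fromBlocks_zero₂₁]
    simp
  have hcong : T * hermPencil M D G (t : ℂ) * star T =
      Matrix.fromBlocks ((-t)⁻¹ • -quadPoly M D (G * Gᴴ) (t : ℂ)) 0 0
        ((-t) • (1 : Matrix (Fin r) (Fin r) ℂ)) := by
    have hP : (t : ℂ) • M + D + (t : ℂ)⁻¹ • (G * Gᴴ) =
        (-t)⁻¹ • -quadPoly M D (G * Gᴴ) (t : ℂ) := by
      ext i j
      simp [quadPoly]
      field_simp
      ring
    have hG : (t : ℂ) • (t : ℂ)⁻¹ • G = G := smul_inv_smul₀ htc G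
    have hG' : (t : ℂ)⁻¹ • (t : ℂ) • Gᴴ = Gᴴ := inv_smul_smul₀ htc Gᴴ
    simp only [Complex.coe_smul] at hG hG'
    rw [← hP]
    simp only [T, hermPencil, Matrix.star_eq_conjTranspose, Matrix.fromBlocks_conjTranspose,
      Matrix.fromBlocks_multiply]
    congr 1
    · simp [hG]
    · simp [hG]
    · simp [hG']
    · ext i j
      simp
  rw [← Matrix.IsUnit.posDef_star_right_conjugate_iff hT, hcong,
    Matrix.posDef_fromBlocks_diagonal_iff]
  refine ⟨fun h => ?_, fun h => ⟨h.smul (inv_pos.2 hneg), Matrix.PosDef.one.smul hneg⟩⟩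
  have := h.1.smul hneg
  rwa [smul_smul, mul_inv_cancel₀ hneg.ne', one_smul] at this

/-- The pencil is the congruence by `diag(C, I)` of `J A - z J`. -/
theorem hermPencil_eq_congruence {M D C : Matrix (Fin n) (Fin n) ℂ} {G : Matrix (Fin n) (Fin r) ℂ}
    (hC : IsUnit C) (hMC : M = C * Cᴴ) (z : ℂ) :
    hermPencil M D G z = Matrix.fromBlocks C 0 0 1 *
      (signJ n r * trimmedLin C D G - z • signJ n r) * star (Matrix.fromBlocks C 0 0 1) := by
  have hCd := (Matrix.isUnit_iff_isUnit_det _).1 hC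
  have hCC : C * C⁻¹ = 1 := Matrix.mul_nonsing_inv _ hCd
  have hCC' : (C⁻¹)ᴴ * Cᴴ = 1 := by
    rw [← Matrix.conjTranspose_mul, hCC, Matrix.conjTranspose_one]
  simp only [hermPencil, signJ, trimmedLin, Matrix.star_eq_conjTranspose,
    Matrix.fromBlocks_conjTranspose, Matrix.fromBlocks_multiply, Matrix.fromBlocks_smul,
    sub_eq_add_neg, Matrix.fromBlocks_neg, Matrix.fromBlocks_add, hMC]
  congr 1
  · have : C * (C⁻¹ * D * (C⁻¹)ᴴ) * Cᴴ = D := by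
      calc C * (C⁻¹ * D * (C⁻¹)ᴴ) * Cᴴ = (C * C⁻¹) * D * ((C⁻¹)ᴴ * Cᴴ) := by noncomm_ring
        _ = D := by rw [hCC, hCC', one_mul, mul_one]
    simp [mul_add, add_mul, this, add_comm]
  · simp [← Matrix.mul_assoc, hCC]
  · simp [Matrix.mul_assoc, hCC']
  · simp

end

/-! ### Assembly of the counts -/

theorem Nat.card_subtype_eq_add {ι : Type} [Fintype ι] {p q s : ι → Prop}
    (h : ∀ i, s i ↔ p i ∨ q i) (hd : ∀ i, ¬ (p i ∧ q i)) :
    Nat.card {i // s i} = Nat.card {i // p i} + Nat.card {i // q i} := by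
  classical
  rw [Nat.card_congr (Equiv.subtypeEquivRight h), Nat.card_eq_fintype_card,
    Nat.card_eq_fintype_card, Nat.card_eq_fintype_card]
  refine Fintype.card_subtype_or_disjoint p q (Pi.disjoint_iff.2 fun i => ?_)
  rw [Prop.disjoint_iff]
  exact hd i

theorem mainTheorem4 {n r : ℕ}
    (M D C : Matrix (Fin n) (Fin n) ℂ) (G : Matrix (Fin n) (Fin r) ℂ)
    (hM : M.PosDef) (hMC : M = C * Cᴴ) (hD : D.PosDef) (hG : G.rank = r)
    (hP : IsHyperbolic M D (G * Gᴴ))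
    (J A : Matrix (Fin n ⊕ Fin r) (Fin n ⊕ Fin r) ℂ)
    (hJ : J = signJ n r) (hA : A = trimmedLin C D G) :
    -- (a)
    (eigCount A (jNegEigs J A) = n ∧ eigCount A (jPosEigs J A) = r) ∧
    -- (b)
    (∃ α : ℝ, (∀ x ∈ jNegEigs J A, x < α) ∧ (∀ x ∈ jPosEigs J A, α < x)) ∧
    -- the extreme eigenvalues exist
    (0 < n → ∃ lm : ℝ, IsGreatest (jNegEigs J A) lm) ∧
    (0 < r → ∃ lp : ℝ, IsLeast (jPosEigs J A) lp) ∧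
    -- (c) and (d)
    (∀ lm lp : ℝ, IsGreatest (jNegEigs J A) lm → IsLeast (jPosEigs J A) lp →
      ∀ μ ∈ Set.Ioo lm lp,
        (J * A - (μ : ℂ) • J).PosDef ∧
        μ < 0 ∧ (hermPencil M D G (μ : ℂ)).PosDef ∧ (-quadPoly M D (G * Gᴴ) (μ : ℂ)).PosDef) ∧
    -- (e), right of the interval
    (∀ lp : ℝ, IsLeast (jPosEigs J A) lp →
      ∀ μ : ℝ, (μ : ℂ) ∉ spectrum ℂ A → lp < μ →
        inertiaPos (J * A - (μ : ℂ) • J) = eigCount A (jPosEigs J A ∩ Set.Ioi μ) + n ∧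
        inertiaNeg (J * A - (μ : ℂ) • J) = eigCount A (jPosEigs J A ∩ Set.Iio μ)) ∧
    -- (e), left of the interval
    (∀ lm : ℝ, IsGreatest (jNegEigs J A) lm →
      ∀ μ : ℝ, (μ : ℂ) ∉ spectrum ℂ A → μ < lm →
        inertiaPos (J * A - (μ : ℂ) • J) = eigCount A (jNegEigs J A ∩ Set.Iio μ) + r ∧
        inertiaNeg (J * A - (μ : ℂ) • J) = eigCount A (jNegEigs J A ∩ Set.Ioi μ)) := by
  subst hJ hA
  have hC : IsUnit C := by
    have h := hM.isUnit
    rw [hMC, Matrix.isUnit_iff_isUnit_det, Matrix.det_mul] at h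
    exact (Matrix.isUnit_iff_isUnit_det _).2 (isUnit_of_mul_isUnit_left h)
  have hV : IsUnit (Matrix.fromBlocks C 0 0 1 : Matrix (Fin n ⊕ Fin r) (Fin n ⊕ Fin r) ℂ) := by
    rw [Matrix.isUnit_iff_isUnit_det, Matrix.det_fromBlocks_zero₂₁]
    simpa using (Matrix.isUnit_iff_isUnit_det _).1 hC
  have hpencil : ∀ x : ℝ, (hermPencil M D G (x : ℂ)).PosDef ↔
      (signJ n r * trimmedLin C D G - (x : ℂ) • signJ n r).PosDef := fun x => by
    rw [hermPencil_eq_congruence hC hMC, Matrix.IsUnit.posDef_star_right_conjugate_iff hV]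
  obtain ⟨t, ht, htP⟩ := hP.exists_neg_posDef_neg_quadPoly hD
    (Matrix.posSemidef_self_mul_conjTranspose G)
  set J := signJ n r with hJdef
  set A := trimmedLin C D G
  have hJ : J.IsHermitian := signJ_isHermitian n r
  have hB : (J * A - (t : ℂ) • J).PosDef := (hpencil t).1 ((posDef_hermPencil_iff ht).2 htP)
  have hH : ∀ x : ℝ, (J * A - (x : ℂ) • J).IsHermitian := fun x => by
    have h1 : J * A - (x : ℂ) • J = (J * A - (t : ℂ) • J) + ((t - x : ℝ) : ℂ) • J := by
      push_cast
      module
    have h2 : (((t - x : ℝ) : ℂ) • J).IsHermitian := by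
      rw [Matrix.IsHermitian, Matrix.conjTranspose_smul, hJ.eq, Complex.star_def,
        Complex.conj_ofReal]
    rw [h1]
    exact hB.1.add h2
  obtain ⟨X, ν, lam, hX, hXJ, hAX, hν⟩ :=
    exists_diagonalization_of_definite hJ (signJ_mul_self n r) hB
  have hpos : ∀ i, 0 < ν i ↔ t < lam i := fun i => by
    rw [← sub_pos (a := lam i)]
    exact pos_iff_pos_of_mul_pos (by rw [hν i]; exact one_pos)
  have hneg : ∀ i, ν i < 0 ↔ lam i < t := fun i => by
    rw [← sub_neg (a := lam i)]
    exact neg_iff_neg_of_mul_pos (by rw [hν i]; exact one_pos)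
  have hne : ∀ i, lam i < t ∨ t < lam i := fun i => by
    rw [← ne_iff_lt_or_gt]
    intro h
    simpa [h] using hν i
  rw [jNegEigs_eq_of_diagonalization hX hXJ hAX hν, jPosEigs_eq_of_diagonalization hX hXJ hAX hν]
  have hr : Nat.card {i // t < lam i} = r := by
    simp only [← hpos]
    rw [← inertiaPos_of_congruence hJ hX hXJ, hJdef, inertiaPos_signJ]
  have hn : Nat.card {i // lam i < t} = n := by
    simp only [← hneg]
    rw [← inertiaNeg_of_congruence hJ hX hXJ, hJdef, inertiaNeg_signJ]
  have hcong := congruence_shift_of_diagonalization hXJ hAX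
  have hposdef : ∀ lm lp : ℝ, IsGreatest (Set.range lam ∩ Set.Iio t) lm →
      IsLeast (Set.range lam ∩ Set.Ioi t) lp → ∀ μ ∈ Set.Ioo lm lp,
        (J * A - (μ : ℂ) • J).PosDef := by
    intro lm lp hlm hlp μ hμ
    rw [← Matrix.IsUnit.posDef_star_left_conjugate_iff hX, Matrix.star_eq_conjTranspose, hcong μ]
    refine Matrix.PosDef.diagonal fun i => Complex.zero_lt_real.2 ?_
    rcases hne i with h | h
    · exact mul_pos_of_neg_of_neg ((hneg i).2 h)
        (sub_neg.2 ((hlm.2 ⟨⟨i, rfl⟩, h⟩).trans_lt hμ.1))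
    · exact mul_pos ((hpos i).2 h) (sub_pos.2 (hμ.2.trans_le (hlp.2 ⟨⟨i, rfl⟩, h⟩)))
  have hsign_pos : ∀ (μ : ℝ) i, 0 < ν i * (lam i - μ) ↔
      (t < lam i ∧ μ < lam i) ∨ (lam i < t ∧ lam i < μ) := fun μ i => by
    rw [mul_pos_iff, hpos, hneg, sub_pos, sub_neg]
  have hsign_neg : ∀ (μ : ℝ) i, ν i * (lam i - μ) < 0 ↔
      (t < lam i ∧ lam i < μ) ∨ (lam i < t ∧ μ < lam i) := fun μ i => by
    rw [mul_neg_iff, hpos, hneg, sub_pos, sub_neg]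
  refine ⟨⟨?_, ?_⟩, ⟨t, fun x hx => hx.2, fun x hx => hx.2⟩, fun h => ?_, fun h => ?_, ?_, ?_, ?_⟩
  · rw [eigCount_of_diagonalization hX hAX]
    simpa using hn
  · rw [eigCount_of_diagonalization hX hAX]
    simpa using hr
  · rw [← hn] at h
    obtain ⟨i, hi⟩ := (Nat.card_pos_iff.1 h).1
    exact ((Set.finite_range lam).inter_of_left _).isCompact.exists_isGreatest ⟨_, ⟨i, rfl⟩, hi⟩
  · rw [← hr] at h
    obtain ⟨i, hi⟩ := (Nat.card_pos_iff.1 h).1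
    exact ((Set.finite_range lam).inter_of_left _).isCompact.exists_isLeast ⟨_, ⟨i, rfl⟩, hi⟩
  · intro lm lp hlm hlp μ hμ
    have h1 := hposdef lm lp hlm hlp μ hμ
    have h2 := (hpencil μ).2 h1
    have hr0 : 0 < r := by
      obtain ⟨⟨i, rfl⟩, hi⟩ := hlp.1
      rw [← hr]
      exact Nat.card_pos_iff.2 ⟨⟨i, hi⟩, inferInstance⟩
    -- a diagonal entry of the block `-μ I` of the pencil
    have hμ0 : μ < 0 := by
      have h3 := h2.diag_pos (i := Sum.inr ⟨0, hr0⟩)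
      simp only [hermPencil, Matrix.fromBlocks_apply₂₂, Matrix.neg_apply, Matrix.smul_apply,
        Matrix.one_apply_eq, smul_eq_mul, mul_one] at h3
      have h4 : (0 : ℂ) < ((-μ : ℝ) : ℂ) := by simpa using h3
      exact neg_pos.1 (Complex.zero_lt_real.1 h4)
    exact ⟨h1, hμ0, h2, (posDef_hermPencil_iff hμ0).1 h2⟩
  · intro lp hlp μ _ hμ
    -- every eigenvalue below `t` is also below `μ`, and contributes a positive entry
    have htμ : t < μ := lt_trans hlp.1.2 hμ
    rw [inertiaPos_of_congruence (hH μ) hX (hcong μ), inertiaNeg_of_congruence (hH μ) hX (hcong μ),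
      eigCount_of_diagonalization hX hAX, eigCount_of_diagonalization hX hAX]
    constructor
    · refine (Nat.card_subtype_eq_add (q := fun i => lam i < t) (fun i => ?_) (fun i => ?_)).trans
        (congrArg _ hn)
      · rw [hsign_pos]
        simp only [Set.mem_inter_iff, Set.mem_range_self, true_and, Set.mem_Ioi]
        grind
      · simp only [Set.mem_inter_iff, Set.mem_range_self, true_and, Set.mem_Ioi]
        grind
    · refine Nat.card_congr (Equiv.subtypeEquivRight fun i => ?_)
      rw [hsign_neg]
      simp only [Set.mem_inter_iff, Set.mem_range_self, true_and, Set.mem_Ioi, Set.mem_Iio]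
      grind
  · intro lm hlm μ _ hμ
    -- every eigenvalue above `t` is also above `μ`, and contributes a positive entry
    have htμ : μ < t := lt_trans hμ hlm.1.2
    rw [inertiaPos_of_congruence (hH μ) hX (hcong μ), inertiaNeg_of_congruence (hH μ) hX (hcong μ),
      eigCount_of_diagonalization hX hAX, eigCount_of_diagonalization hX hAX]
    constructor
    · refine (Nat.card_subtype_eq_add (q := fun i => t < lam i) (fun i => ?_) (fun i => ?_)).trans
        (congrArg _ hr)
      · rw [hsign_pos]
        simp only [Set.mem_inter_iff, Set.mem_range_self, true_and, Set.mem_Iio]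
        grind
      · simp only [Set.mem_inter_iff, Set.mem_range_self, true_and, Set.mem_Iio]
        grind
    · refine Nat.card_congr (Equiv.subtypeEquivRight fun i => ?_)
      rw [hsign_neg]
      simp only [Set.mem_inter_iff, Set.mem_range_self, true_and, Set.mem_Ioi, Set.mem_Iio]
      grind
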